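/- Let $\Bbbk$ be a field, let $n \ge 1$ be an integer, and let $0 \ne v \in \Bbbk$ with $v+v^{-1} \ne 0$. For $\delta \in \Bbbk$, let $\mathrm{TL}_n(\delta)$ denote the Temperley--Lieb algebra, i.e. the unital associative $\Bbbk$-algebra with generators $e_1, \dots, e_{n-1}$ and relations $$e_i^2 = \delta e_i, \qquad e_i e_j e_i = e_i \ \text{ if } |i-j|=1, \qquad e_i e_j = e_j e_i \ \text{ if } |i-j|>1 .$$ For $m \ge 1$ put $[m]_v = \sum_{j=0}^{m-1} v^{-(m-1)+2j}$, and let $[n]_v^! = [1]_v [2]_v \cdots [n]_v$. If $[n]_v^! \ne 0$ in $\Bbbk$, then both $\mathrm{TL}_n(v+v^{-1})$ and $\mathrm{TL}_n(-(v+v^{-1}))$ are split semisimple over $\Bbbk$, that is, each is isomorphic as a $\Bbbk$-algebra to a finite product of matrix algebras $\prod_{i} M_{d_i}(\Bbbk)$ with $d_i \ge 1$. -/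

import Mathlib

/-- The defining relations of the Temperley--Lieb algebra `TL_n(δ)` on the free algebra on
`n - 1` letters. The letter `i : Fin (n - 1)` stands for the generator `e_{i+1}`. -/
inductive TemperleyLiebRel {k : Type*} [CommRing k] (n : ℕ) (δ : k) :
    FreeAlgebra k (Fin (n - 1)) → FreeAlgebra k (Fin (n - 1)) → Prop
  | sq (i : Fin (n - 1)) :
      TemperleyLiebRel n δ (FreeAlgebra.ι k i * FreeAlgebra.ι k i) (δ • FreeAlgebra.ι k i)
  | braid (i j : Fin (n - 1)) (h : |(i : ℤ) - (j : ℤ)| = 1) :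
      TemperleyLiebRel n δ
        (FreeAlgebra.ι k i * FreeAlgebra.ι k j * FreeAlgebra.ι k i) (FreeAlgebra.ι k i)
  | comm (i j : Fin (n - 1)) (h : 1 < |(i : ℤ) - (j : ℤ)|) :
      TemperleyLiebRel n δ
        (FreeAlgebra.ι k i * FreeAlgebra.ι k j) (FreeAlgebra.ι k j * FreeAlgebra.ι k i)

/-- The Temperley--Lieb algebra `TL_n(δ)` over `k` (for `n ≥ 1`): the unital associative
`k`-algebra with generators `e_1, …, e_{n-1}` and the Temperley--Lieb relations. -/
abbrev TemperleyLieb {k : Type*} [CommRing k] (n : ℕ) (δ : k) :=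
  RingQuot (TemperleyLiebRel n δ)

/-- A `k`-algebra is split semisimple if it is isomorphic, as a `k`-algebra, to a finite
product of full matrix algebras over `k` itself. -/
def IsSplitSemisimple (k : Type*) (A : Type*) [Field k] [Ring A] [Algebra k A] : Prop :=
  ∃ (r : ℕ) (d : Fin r → ℕ), (∀ i, 0 < d i) ∧
    Nonempty (A ≃ₐ[k] ((i : Fin r) → Matrix (Fin (d i)) (Fin (d i)) k))

/-- The balanced Gaussian integer `[n]_v = ∑_{j=0}^{n-1} v^{-(n-1)+2j}`. -/
def balancedInt {k : Type*} [Field k] (v : k) (n : ℕ) : k :=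
  ∑ j ∈ Finset.range n, v ^ (-((n : ℤ) - 1) + 2 * (j : ℤ))

/-- The balanced quantum factorial `[n]_v^! = [1]_v [2]_v ⋯ [n]_v`, with `[0]_v^! = 1`. -/
def balancedFactorial {k : Type*} [Field k] (v : k) (n : ℕ) : k :=
  ∏ m ∈ Finset.Icc 1 n, balancedInt v m

/-! A split frame forces split semisimplicity: the algebra `A` acts faithfully on the left ideals `A
q i`, each `a * q i * b` acts with rank at most one on `A q i` and by zero on the others, and 1 is a
combination of such elements. Hence `A` maps isomorphically onto the product of the `End (A q i)`.
The `q i` need not be idempotent.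

Frames are built by induction in steps of two strands. Let `C n` be the subalgebra on n strands, `e
n` the last generator of `C (n + 2)`, and f the Jones--Wenzl element of `C (n + 2)`. Compression
gives `e n * C (n + 2) * e n ⊆ C n * e n`, and `e n` commutes with `C n`, so a frame `q i` of `C n`
yields the elements `q i * e n`. Since f is killed by all generators of `C (n + 2)` and 1 - f lies
in the ideal generated by `e n`, adjoining f completes the frame (`HasSplitFrame.extend`). The
quantum integers are the denominators of f, so their nonvanishing is exactly what the construction
needs. No basis or dimension count is involved. -/

/-- A finite family of elements `q i` of a subalgebra `S` such that `q i S q i ⊆ k q i`,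
`q i S q j = 0` for `i ≠ j`, and the two-sided ideals `S (q i) S` together contain `1`. -/
def HasSplitFrame {k A : Type*} [Field k] [Ring A] [Algebra k A] (S : Subalgebra k A) : Prop :=
  ∃ (ι : Type) (_ : Finite ι) (q : ι → A), (∀ i, q i ∈ S) ∧
    (∀ i, ∀ x ∈ S, ∃ c : k, q i * x * q i = c • q i) ∧
    (∀ i j, i ≠ j → ∀ x ∈ S, q i * x * q j = 0) ∧
    (1 : A) ∈ Submodule.span k {y | ∃ i, ∃ a ∈ S, ∃ b ∈ S, y = a * q i * b}

/-! ### Split frames and split semisimplicity -/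

section SplitFrame

variable {k A : Type*} [Field k] [Ring A] [Algebra k A]

/-- The action of `A` by left multiplication on the left ideals generated by the `q i`. -/
def leftIdealsAction (k : Type*) {A : Type*} [Field k] [Ring A] [Algebra k A] {r : ℕ}
    (q : Fin r → A) :
    A →ₐ[k] ((i : Fin r) → Module.End k (Submodule.span A {q i})) :=
  AlgHom.pi fun i => Algebra.lsmul k k (Submodule.span A {q i})

theorem leftIdealsAction_apply_coe {r : ℕ} (q : Fin r → A) (a : A) (i : Fin r)
    (x : Submodule.span A {q i}) : (leftIdealsAction k q a i x : A) = a * x := rfl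

theorem leftIdealsAction_injective {r : ℕ} (q : Fin r → A)
    (h : (1 : A) ∈ Submodule.span k {y | ∃ i a b, y = a * q i * b}) :
    Function.Injective (leftIdealsAction k q) := by
  rw [injective_iff_map_eq_zero]
  intro z hz
  have key : ∀ y ∈ Submodule.span k {y | ∃ i a b, y = a * q i * b}, z * y = 0 := by
    intro y hy
    induction hy using Submodule.span_induction with
    | mem y hy =>
      obtain ⟨i, a, b, rfl⟩ := hy
      have h1 := leftIdealsAction_apply_coe (k := k) q z i
        ⟨a * q i, Submodule.mem_span_singleton.2 ⟨a, rfl⟩⟩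
      rw [hz] at h1
      have h2 : z * (a * q i) = 0 := h1.symm
      rw [← mul_assoc, h2, zero_mul]
    | zero => simp
    | add x y _ _ hx hy => rw [mul_add, hx, hy, add_zero]
    | smul c x _ hx => rw [mul_smul_comm, hx, smul_zero]
  simpa using key 1 h

/-- The elements y for which T composed with the action of y comes from `A` form a subspace. It
contains every `a * q i * b`, hence 1, and so T itself comes from `A`. -/
theorem leftIdealsAction_surjective {r : ℕ} (q : Fin r → A)
    (hd : ∀ i x, ∃ c : k, q i * x * q i = c • q i)
    (ho : ∀ i j, i ≠ j → ∀ x, q i * x * q j = 0)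
    (h : (1 : A) ∈ Submodule.span k {y | ∃ i a b, y = a * q i * b}) :
    Function.Surjective (leftIdealsAction k q) := by
  intro T
  have key : ∀ y ∈ Submodule.span k {y | ∃ i a b, y = a * q i * b},
      ∃ z, ∀ j x, T j (leftIdealsAction k q y j x) = leftIdealsAction k q z j x := by
    intro y hy
    induction hy using Submodule.span_induction with
    | mem y hy =>
      obtain ⟨i, a, b, rfl⟩ := hy
      set w : Submodule.span A {q i} := ⟨a * q i, Submodule.mem_span_singleton.2 ⟨a, rfl⟩⟩ with hw
      obtain ⟨a', ha'⟩ := Submodule.mem_span_singleton.1 (T i w).2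
      rw [smul_eq_mul] at ha'
      refine ⟨a' * q i * b, fun j x => ?_⟩
      obtain ⟨c, hc⟩ := Submodule.mem_span_singleton.1 x.2
      rw [smul_eq_mul] at hc
      by_cases hij : i = j
      · subst hij
        -- The scalar l depends only on b and c, so composing with T merely replaces `a * q i` by
        -- its image `a' * q i`.
        obtain ⟨l, hl⟩ := hd i (b * c)
        have h1 : ∀ a'' : A, a'' * q i * b * x = l • (a'' * q i) := by
          intro a''
          rw [← hc, ← mul_smul_comm, ← hl]
          simp only [mul_assoc]
        have h2 : leftIdealsAction k q (a * q i * b) i x = l • w := by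
          ext
          rw [leftIdealsAction_apply_coe, h1]
          rfl
        rw [h2, map_smul]
        ext
        rw [leftIdealsAction_apply_coe, h1, ha']
        rfl
      · have h1 : ∀ a'' : A, leftIdealsAction k q (a'' * q i * b) j x = 0 := by
          intro a''
          ext
          rw [leftIdealsAction_apply_coe, ← hc]
          have := ho i j hij (b * c)
          simp only [mul_assoc] at this ⊢
          rw [this, mul_zero]
          rfl
        rw [h1, h1, map_zero]
    | zero => exact ⟨0, fun j x => by simp⟩
    | add x y _ _ hx hy =>
      obtain ⟨z, hz⟩ := hx
      obtain ⟨z', hz'⟩ := hy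
      exact ⟨z + z', fun j x => by simp [hz, hz']⟩
    | smul c x _ hx =>
      obtain ⟨z, hz⟩ := hx
      exact ⟨c • z, fun j x => by simp [hz]⟩
  obtain ⟨z, hz⟩ := key 1 h
  refine ⟨z, ?_⟩
  funext j
  ext x : 1
  rw [← hz, map_one]
  rfl

/-- Each `a * q i * b` acts on `A q j` with finite-dimensional image, and the identity is a
combination of these actions. -/
theorem finite_span_singleton {r : ℕ} (q : Fin r → A)
    (hd : ∀ i x, ∃ c : k, q i * x * q i = c • q i)
    (ho : ∀ i j, i ≠ j → ∀ x, q i * x * q j = 0)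
    (h : (1 : A) ∈ Submodule.span k {y | ∃ i a b, y = a * q i * b}) (j : Fin r) :
    Module.Finite k (Submodule.span A {q j}) := by
  have key : ∀ y ∈ Submodule.span k {y | ∃ i a b, y = a * q i * b},
      ∃ W : Submodule k (Submodule.span A {q j}), W.FG ∧
        ∀ x, leftIdealsAction k q y j x ∈ W := by
    intro y hy
    induction hy using Submodule.span_induction with
    | mem y hy =>
      obtain ⟨i, a, b, rfl⟩ := hy
      by_cases hij : i = j
      · subst hij
        set w : Submodule.span A {q i} := ⟨a * q i, Submodule.mem_span_singleton.2 ⟨a, rfl⟩⟩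
        refine ⟨Submodule.span k {w}, Submodule.fg_span_singleton _, fun x => ?_⟩
        obtain ⟨c, hc⟩ := Submodule.mem_span_singleton.1 x.2
        rw [smul_eq_mul] at hc
        obtain ⟨l, hl⟩ := hd i (b * c)
        refine Submodule.mem_span_singleton.2 ⟨l, ?_⟩
        ext
        rw [leftIdealsAction_apply_coe, ← hc]
        change l • (a * q i) = _
        rw [← mul_smul_comm, ← hl]
        simp only [mul_assoc]
      · refine ⟨⊥, Submodule.fg_bot, fun x => ?_⟩
        obtain ⟨c, hc⟩ := Submodule.mem_span_singleton.1 x.2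
        rw [smul_eq_mul] at hc
        rw [Submodule.mem_bot]
        ext
        rw [leftIdealsAction_apply_coe, ← hc]
        have := ho i j hij (b * c)
        simp only [mul_assoc] at this ⊢
        rw [this, mul_zero]
        rfl
    | zero => exact ⟨⊥, Submodule.fg_bot, fun x => by simp⟩
    | add x y _ _ hx hy =>
      obtain ⟨W, hW, hx⟩ := hx
      obtain ⟨W', hW', hy⟩ := hy
      refine ⟨W ⊔ W', hW.sup hW', fun u => ?_⟩
      rw [map_add]
      exact Submodule.add_mem_sup (hx u) (hy u)
    | smul c x _ hx =>
      obtain ⟨W, hW, hx⟩ := hx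
      refine ⟨W, hW, fun u => ?_⟩
      rw [map_smul]
      exact W.smul_mem c (hx u)
  obtain ⟨W, hW, h1⟩ := key 1 h
  have : W = ⊤ := by
    rw [eq_top_iff]
    intro x _
    simpa using h1 x
  exact ⟨this ▸ hW⟩

theorem isSplitSemisimple_of_ne_zero {r : ℕ} (q : Fin r → A) (hq : ∀ i, q i ≠ 0)
    (hd : ∀ i x, ∃ c : k, q i * x * q i = c • q i)
    (ho : ∀ i j, i ≠ j → ∀ x, q i * x * q j = 0)
    (h : (1 : A) ∈ Submodule.span k {y | ∃ i a b, y = a * q i * b}) :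
    IsSplitSemisimple k A := by
  have hfin := finite_span_singleton q hd ho h
  refine ⟨r, fun i => Module.finrank k (Submodule.span A {q i}), fun i => ?_, ⟨?_⟩⟩
  · have : Nontrivial (Submodule.span A {q i}) :=
      ⟨⟨⟨q i, Submodule.mem_span_singleton_self _⟩, 0, fun h0 => hq i (congrArg Subtype.val h0)⟩⟩
    exact Module.finrank_pos
  · exact (AlgEquiv.ofBijective (leftIdealsAction k q)
      ⟨leftIdealsAction_injective q h, leftIdealsAction_surjective q hd ho h⟩).trans
      (AlgEquiv.piCongrRight fun i => algEquivMatrix (Module.finBasis k _))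

theorem HasSplitFrame.isSplitSemisimple (h : HasSplitFrame (⊤ : Subalgebra k A)) :
    IsSplitSemisimple k A := by
  obtain ⟨ι, _, q, -, hd, ho, h1⟩ := h
  -- Matrix blocks must have positive size, so zero members of the frame are dropped; they
  -- contribute nothing to the span.
  let φ := Finite.equivFin {i // q i ≠ 0}
  refine isSplitSemisimple_of_ne_zero (fun s => q (φ.symm s)) (fun s => (φ.symm s).2)
    (fun s x => hd _ x trivial)
    (fun s t hst x => ho _ _ (fun h => hst (φ.symm.injective (Subtype.ext h))) x trivial) ?_
  refine Submodule.span_le.2 ?_ h1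
  rintro _ ⟨i, a, -, b, -, rfl⟩
  by_cases hi : q i = 0
  · simp [hi]
  · exact Submodule.subset_span ⟨φ ⟨i, hi⟩, a, b, by simp⟩

/-- The basic construction for split frames. -/
theorem HasSplitFrame.extend {S T : Subalgebra k A} (hS : HasSplitFrame S) (hST : S ≤ T)
    {e f : A} (heT : e ∈ T) (hfT : f ∈ T) (hcomm : ∀ x ∈ S, Commute e x)
    (hete : ∀ x ∈ T, ∃ y ∈ S, e * x * e = y * e)
    (hfx : ∀ x ∈ T, ∃ c : k, f * x = c • f) (hxf : ∀ x ∈ T, ∃ c : k, x * f = c • f)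
    (hfe : f * e = 0) (hef : e * f = 0)
    (h1 : 1 - f ∈ Submodule.span k {y | ∃ a ∈ T, ∃ b ∈ T, y = a * e * b}) :
    HasSplitFrame T := by
  obtain ⟨ι, _, q, hqS, hd, ho, hone⟩ := hS
  have hqeT : ∀ i, q i * e ∈ T := fun i => T.mul_mem (hST (hqS i)) heT
  have hswap : ∀ i, q i * e = e * q i := fun i => (hcomm _ (hqS i)).eq.symm
  have hmid : ∀ i j, ∀ x ∈ T, ∃ y ∈ S, (q i * e) * x * (q j * e) = (q i * y * q j) * e := by
    intro i j x hx
    obtain ⟨y, hy, hye⟩ := hete x hx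
    refine ⟨y, hy, ?_⟩
    calc (q i * e) * x * (q j * e) = q i * (e * x * e) * q j := by
          rw [hswap j]; simp only [mul_assoc]
      _ = q i * y * (e * q j) := by rw [hye]; simp only [mul_assoc]
      _ = _ := by rw [← hswap j]; simp only [mul_assoc]
  have hff : ∀ x ∈ T, ∃ c : k, f * x * f = c • f := by
    intro x hx
    exact hxf _ (T.mul_mem hfT hx)
  refine ⟨Option ι, inferInstance, fun o => o.elim f fun i => q i * e, ?_, ?_, ?_, ?_⟩
  · rintro (_ | i)
    exacts [hfT, hqeT i]
  · rintro (_ | i) x hx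
    · exact hff x hx
    · obtain ⟨y, hy, h⟩ := hmid i i x hx
      obtain ⟨c, hc⟩ := hd i y hy
      exact ⟨c, by simp only [Option.elim]; rw [h, hc, smul_mul_assoc]⟩
  · rintro (_ | i) (_ | j) hij x hx
    · exact absurd rfl hij
    · obtain ⟨c, hc⟩ := hfx x hx
      simp only [Option.elim]
      rw [hc, hswap, smul_mul_assoc, ← mul_assoc, hfe, zero_mul, smul_zero]
    · obtain ⟨c, hc⟩ := hxf x hx
      simp only [Option.elim]
      rw [mul_assoc, hc, mul_smul_comm, mul_assoc, hef, mul_zero, smul_zero]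
    · obtain ⟨y, hy, h⟩ := hmid i j x hx
      simp only [Option.elim]
      rw [h, ho i j (fun h => hij (congrArg some h)) y hy, zero_mul]
  · set P := Submodule.span k {y | ∃ o : Option ι, ∃ a ∈ T, ∃ b ∈ T,
      y = a * (o.elim f fun i => q i * e) * b} with hP
    have hf : f ∈ P := Submodule.subset_span ⟨none, 1, T.one_mem, 1, T.one_mem, by simp⟩
    -- As e commutes with S, `(c * q i * d) * e = c * (q i * e) * d`. Taking z = 1 then puts every
    -- `a * e * b` in P.
    have hz : ∀ z ∈ Submodule.span k {y | ∃ i, ∃ a ∈ S, ∃ b ∈ S, y = a * q i * b},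
        ∀ a ∈ T, ∀ b ∈ T, a * (z * e) * b ∈ P := by
      intro z hz a ha b hb
      induction hz using Submodule.span_induction with
      | mem z hz =>
        obtain ⟨i, c, hc, d, hd, rfl⟩ := hz
        refine Submodule.subset_span ⟨some i, a * c, T.mul_mem ha (hST hc), d * b,
          T.mul_mem (hST hd) hb, ?_⟩
        have := (hcomm d hd).eq
        simp only [Option.elim, mul_assoc]
        rw [← mul_assoc e d b, this, mul_assoc]
      | zero => simp
      | add x y _ _ hx hy =>
        rw [add_mul, mul_add, add_mul]
        exact P.add_mem hx hy
      | smul c x _ hx =>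
        rw [smul_mul_assoc, mul_smul_comm, smul_mul_assoc]
        exact P.smul_mem c hx
    have h2 : 1 - f ∈ P := by
      refine Submodule.span_le.2 ?_ h1
      rintro _ ⟨a, ha, b, hb, rfl⟩
      simpa using hz 1 hone a ha b hb
    simpa using P.add_mem h2 hf

theorem hasSplitFrame_bot : HasSplitFrame (⊥ : Subalgebra k A) := by
  refine ⟨Unit, inferInstance, fun _ => 1, fun _ => Subalgebra.one_mem _, ?_, ?_, ?_⟩
  · rintro - x hx
    obtain ⟨c, rfl⟩ := Algebra.mem_bot.1 hx
    exact ⟨c, by simp [Algebra.algebraMap_eq_smul_one]⟩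
  · exact fun i j hij => absurd (Subsingleton.elim i j) hij
  · exact Submodule.subset_span ⟨(), 1, Subalgebra.one_mem _, 1, Subalgebra.one_mem _, by simp⟩

end SplitFrame

/-! ### The tower of strand subalgebras and compression -/

section Tower

variable {k A : Type*} [Field k] [Ring A] [Algebra k A]

/-- The subalgebra generated by the elements `e i` with `i + 1 < n`. -/
def strandSubalgebra (k : Type*) {A : Type*} [Field k] [Ring A] [Algebra k A] (e : ℕ → A)
    (n : ℕ) : Subalgebra k A :=
  Algebra.adjoin k {x | ∃ i, i + 1 < n ∧ e i = x}

theorem mem_strandSubalgebra (e : ℕ → A) {n i : ℕ} (h : i + 1 < n) :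
    e i ∈ strandSubalgebra k e n :=
  Algebra.subset_adjoin ⟨i, h, rfl⟩

theorem strandSubalgebra_mono (e : ℕ → A) : Monotone (strandSubalgebra k e) := by
  intro m n h
  refine Algebra.adjoin_mono ?_
  rintro _ ⟨i, hi, rfl⟩
  exact ⟨i, by omega, rfl⟩

theorem strandSubalgebra_eq_bot (e : ℕ → A) {n : ℕ} (h : n ≤ 1) :
    strandSubalgebra k e n = ⊥ := by
  rw [strandSubalgebra, ← Algebra.adjoin_empty]
  congr 1
  ext x
  simp only [Set.mem_ofPred_eq, Set.mem_empty_iff_false, iff_false]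
  rintro ⟨i, hi, -⟩
  omega

theorem commute_strandSubalgebra {e : ℕ → A} (hcomm : ∀ i j, i + 1 < j → Commute (e j) (e i))
    {n j : ℕ} (h : n ≤ j) {x : A} (hx : x ∈ strandSubalgebra k e n) : Commute (e j) x := by
  induction hx using Algebra.adjoin_induction with
  | mem x hx =>
    obtain ⟨i, hi, rfl⟩ := hx
    exact hcomm i j (by omega)
  | algebraMap r => exact Algebra.commute_algebraMap_right r _
  | add x y _ _ hx hy => exact hx.add_right hy
  | mul x y _ _ hx hy => exact hx.mul_right hy

/-- The sum of `C (n + 1)` and `C (n + 1) (e n) C (n + 1)`, with `C = strandSubalgebra k e`. -/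
def onceSpan (k : Type*) {A : Type*} [Field k] [Ring A] [Algebra k A] (e : ℕ → A) (n : ℕ) :
    Submodule k A :=
  Submodule.span k ((strandSubalgebra k e (n + 1) : Set A) ∪
    {x | ∃ y ∈ strandSubalgebra k e (n + 1), ∃ z ∈ strandSubalgebra k e (n + 1),
      x = y * e n * z})

/-- The hypothesis `hspan` is `mem_onceSpan` one level down, so that the strong induction proving
`mem_onceSpan` can call this lemma. Elements of `C n` commute past `e n` and leave a factor δ; for
`y * e m * z` both outer factors commute with `e n` and the braid relation applies. -/
theorem exists_compress_of_mem_strandSubalgebra_succ {e : ℕ → A} {δ : k}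
    (hsq : ∀ i, e i * e i = δ • e i)
    (hbraid : ∀ i, e (i + 1) * e i * e (i + 1) = e (i + 1))
    (hcomm : ∀ i j, i + 1 < j → Commute (e j) (e i)) {n : ℕ}
    (hspan : ∀ m, m + 1 = n → ∀ x ∈ strandSubalgebra k e (m + 2), x ∈ onceSpan k e m)
    {x : A} (hx : x ∈ strandSubalgebra k e (n + 1)) :
    ∃ y ∈ strandSubalgebra k e n, e n * x * e n = y * e n := by
  have hsq' : ∀ x ∈ strandSubalgebra k e n, e n * x * e n = (δ • x) * e n := by
    intro x hx
    rw [(commute_strandSubalgebra hcomm le_rfl hx).eq, mul_assoc, hsq, mul_smul_comm,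
      smul_mul_assoc]
  rcases n with _ | m
  · rw [strandSubalgebra_eq_bot e (by omega : 0 + 1 ≤ 1),
      ← strandSubalgebra_eq_bot e (by omega : 0 ≤ 1)] at hx
    exact ⟨δ • x, Subalgebra.smul_mem _ hx δ, hsq' x hx⟩
  · have hx' := hspan m rfl x hx
    rw [onceSpan] at hx'
    clear hx
    induction hx' using Submodule.span_induction with
    | mem x hx =>
      rcases hx with hx | ⟨y, hy, z, hz, rfl⟩
      · exact ⟨δ • x, Subalgebra.smul_mem _ hx δ, hsq' x hx⟩
      · refine ⟨y * z, Subalgebra.mul_mem _ hy hz, ?_⟩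
        have h1 := (commute_strandSubalgebra hcomm le_rfl hy).eq
        have h2 := (commute_strandSubalgebra hcomm le_rfl hz).eq
        calc e (m + 1) * (y * e m * z) * e (m + 1)
            = (e (m + 1) * y) * e m * (z * e (m + 1)) := by simp only [mul_assoc]
          _ = y * (e (m + 1) * e m * e (m + 1)) * z := by
            rw [h1, ← h2]; simp only [mul_assoc]
          _ = y * z * e (m + 1) := by rw [hbraid, mul_assoc, h2, mul_assoc]
    | zero => exact ⟨0, Subalgebra.zero_mem _, by simp⟩
    | add x y _ _ hx hy =>
      obtain ⟨x', hx', h1⟩ := hx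
      obtain ⟨y', hy', h2⟩ := hy
      exact ⟨x' + y', Subalgebra.add_mem _ hx' hy', by rw [mul_add, add_mul, h1, h2, add_mul]⟩
    | smul c x _ hx =>
      obtain ⟨x', hx', h1⟩ := hx
      exact ⟨c • x', Subalgebra.smul_mem _ hx' c, by
        rw [mul_smul_comm, smul_mul_assoc, h1, smul_mul_assoc]⟩

/-- The span contains 1 and is stable under left multiplication by the generators. Only `e n * (y *
e n * z)` needs an argument: compression removes one of the two occurrences of `e n`. -/
theorem mem_onceSpan {e : ℕ → A} {δ : k}
    (hsq : ∀ i, e i * e i = δ • e i)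
    (hbraid : ∀ i, e (i + 1) * e i * e (i + 1) = e (i + 1))
    (hcomm : ∀ i j, i + 1 < j → Commute (e j) (e i)) (n : ℕ) :
    ∀ x ∈ strandSubalgebra k e (n + 2), x ∈ onceSpan k e n := by
  induction n using Nat.strong_induction_on with
  | _ n ih =>
  have hsub : ∀ x ∈ strandSubalgebra k e (n + 1), x ∈ onceSpan k e n :=
    fun x hx => Submodule.subset_span (Or.inl hx)
  have hmem : ∀ y ∈ strandSubalgebra k e (n + 1), ∀ z ∈ strandSubalgebra k e (n + 1),
      y * e n * z ∈ onceSpan k e n :=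
    fun y hy z hz => Submodule.subset_span (Or.inr ⟨y, hy, z, hz, rfl⟩)
  have hgen : ∀ i, i + 1 < n + 2 → ∀ y ∈ onceSpan k e n, e i * y ∈ onceSpan k e n := by
    intro i hi y hy
    rw [onceSpan] at hy
    induction hy using Submodule.span_induction with
    | mem y hy =>
      rcases Nat.lt_or_ge (i + 1) (n + 1) with h | h
      · have hei := mem_strandSubalgebra (k := k) e h
        rcases hy with hy | ⟨y, hy, z, hz, rfl⟩
        · exact hsub _ (Subalgebra.mul_mem _ hei hy)
        · have := hmem _ (Subalgebra.mul_mem _ hei hy) z hz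
          simpa only [mul_assoc] using this
      · obtain rfl : i = n := by omega
        rcases hy with hy | ⟨y, hy, z, hz, rfl⟩
        · simpa using hmem 1 (Subalgebra.one_mem _) y hy
        · obtain ⟨y', hy', h'⟩ := exists_compress_of_mem_strandSubalgebra_succ hsq hbraid hcomm
            (fun m hm => ih m (by omega)) hy
          have := hmem y' (strandSubalgebra_mono e (Nat.le_succ i) hy') z hz
          rwa [← h', mul_assoc (e i * y), mul_assoc (e i), ← mul_assoc y] at this
    | zero => simp
    | add x y _ _ hx hy => rw [mul_add]; exact Submodule.add_mem _ hx hy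
    | smul c x _ hx => rw [mul_smul_comm]; exact Submodule.smul_mem _ c hx
  have hmul : ∀ x ∈ strandSubalgebra k e (n + 2), ∀ y ∈ onceSpan k e n,
      x * y ∈ onceSpan k e n := by
    intro x hx
    induction hx using Algebra.adjoin_induction with
    | mem x hx =>
      obtain ⟨i, hi, rfl⟩ := hx
      exact hgen i hi
    | algebraMap r =>
      intro y hy
      rw [← Algebra.smul_def]
      exact Submodule.smul_mem _ r hy
    | add x y _ _ hx hy =>
      intro z hz
      rw [add_mul]
      exact Submodule.add_mem _ (hx z hz) (hy z hz)
    | mul x y _ _ hx hy =>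
      intro z hz
      rw [mul_assoc]
      exact hx _ (hy z hz)
  intro x hx
  simpa using hmul x hx 1 (hsub 1 (Subalgebra.one_mem _))

/-- Compression by `e n` maps `C (n + 2)` into `C n (e n)`, with `C = strandSubalgebra k e`. -/
theorem exists_compress {e : ℕ → A} {δ : k}
    (hsq : ∀ i, e i * e i = δ • e i)
    (hbraid : ∀ i, e (i + 1) * e i * e (i + 1) = e (i + 1))
    (hcomm : ∀ i j, i + 1 < j → Commute (e j) (e i)) {n : ℕ}
    {x : A} (hx : x ∈ strandSubalgebra k e (n + 2)) :
    ∃ y ∈ strandSubalgebra k e n, e n * x * e n = y * e n := by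
  have hle := strandSubalgebra_mono (k := k) e (Nat.le_succ n)
  have hc : ∀ x ∈ strandSubalgebra k e (n + 1),
      ∃ y ∈ strandSubalgebra k e n, e n * x * e n = y * e n := fun x hx =>
    exists_compress_of_mem_strandSubalgebra_succ hsq hbraid hcomm
      (fun m _ => mem_onceSpan hsq hbraid hcomm m) hx
  have hx' := mem_onceSpan hsq hbraid hcomm n x hx
  rw [onceSpan] at hx'
  clear hx
  induction hx' using Submodule.span_induction with
  | mem x hx =>
    rcases hx with hx | ⟨y, hy, z, hz, rfl⟩
    · exact hc x hx
    · obtain ⟨y', hy', h1⟩ := hc y hy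
      obtain ⟨z', hz', h2⟩ := hc z hz
      refine ⟨y' * z', Subalgebra.mul_mem _ hy' hz', ?_⟩
      calc e n * (y * e n * z) * e n = (e n * y * e n) * z * e n := by simp only [mul_assoc]
        _ = y' * (e n * z * e n) := by rw [h1]; simp only [mul_assoc]
        _ = _ := by rw [h2, mul_assoc]
  | zero => exact ⟨0, Subalgebra.zero_mem _, by simp⟩
  | add x y _ _ hx hy =>
    obtain ⟨x', hx', h1⟩ := hx
    obtain ⟨y', hy', h2⟩ := hy
    exact ⟨x' + y', Subalgebra.add_mem _ hx' hy', by rw [mul_add, add_mul, h1, h2, add_mul]⟩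
  | smul c x _ hx =>
    obtain ⟨x', hx', h1⟩ := hx
    exact ⟨c • x', Subalgebra.smul_mem _ hx' c, by
      rw [mul_smul_comm, smul_mul_assoc, h1, smul_mul_assoc]⟩

/-! ### Jones--Wenzl elements -/

/-- The Jones--Wenzl elements on the generators `e`, with quantum integers `U`. -/
def jonesWenzl (U : ℕ → k) (e : ℕ → A) : ℕ → A
  | 0 => 1
  | 1 => 1
  | n + 2 => jonesWenzl U e (n + 1) -
      (U (n + 1) / U (n + 2)) • (jonesWenzl U e (n + 1) * e n * jonesWenzl U e (n + 1))

theorem jonesWenzl_mem (U : ℕ → k) (e : ℕ → A) (n : ℕ) :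
    jonesWenzl U e n ∈ strandSubalgebra k e n := by
  induction n using jonesWenzl.induct with
  | case1 => exact Subalgebra.one_mem _
  | case2 => exact Subalgebra.one_mem _
  | case3 n ih =>
    have h := strandSubalgebra_mono e (Nat.le_succ (n + 1)) ih
    rw [jonesWenzl]
    exact Subalgebra.sub_mem _ h (Subalgebra.smul_mem _ (Subalgebra.mul_mem _
      (Subalgebra.mul_mem _ h (mem_strandSubalgebra e (by omega))) h) _)

theorem jonesWenzl_mul_of_forall {U : ℕ → k} {e : ℕ → A} {n : ℕ} {x : A}
    (h : ∀ i, i + 1 < n → e i * x = 0) : jonesWenzl U e n * x = x := by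
  induction n using jonesWenzl.induct with
  | case1 => exact one_mul x
  | case2 => exact one_mul x
  | case3 n ih =>
    have h1 := ih fun i hi => h i (by omega)
    rw [jonesWenzl, sub_mul, smul_mul_assoc, mul_assoc, h1, mul_assoc, h n (by omega), mul_zero,
      smul_zero, sub_zero]

theorem mul_jonesWenzl_of_forall {U : ℕ → k} {e : ℕ → A} {n : ℕ} {x : A}
    (h : ∀ i, i + 1 < n → x * e i = 0) : x * jonesWenzl U e n = x := by
  induction n using jonesWenzl.induct with
  | case1 => exact mul_one x
  | case2 => exact mul_one x
  | case3 n ih =>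
    have h1 := ih fun i hi => h i (by omega)
    rw [jonesWenzl, mul_sub, mul_smul_comm, ← mul_assoc, ← mul_assoc, h1, h n (by omega), zero_mul,
      smul_zero, sub_zero]

/-- Annihilation at the next level needs the value of `e n * f * e n`, which in turn needs
idempotence of f, so all the claims are proved in one induction. `U (n + 2)` may vanish here, as it
occurs only in a numerator. -/
theorem jonesWenzl_annihilates {U : ℕ → k} {e : ℕ → A} {δ : k}
    (hsq : ∀ i, e i * e i = δ • e i)
    (hbraid : ∀ i, e (i + 1) * e i * e (i + 1) = e (i + 1))
    (hcomm : ∀ i j, i + 1 < j → Commute (e j) (e i))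
    (hU1 : U 1 = 1) (hU2 : U 2 = δ) (hU : ∀ n, U (n + 3) = δ * U (n + 2) - U (n + 1))
    (n : ℕ) (hne : ∀ m, 1 ≤ m → m ≤ n + 1 → U m ≠ 0) :
    (∀ i, i + 1 < n + 1 → e i * jonesWenzl U e (n + 1) = 0 ∧ jonesWenzl U e (n + 1) * e i = 0) ∧
    e n * jonesWenzl U e (n + 1) * e n =
      (U (n + 2) / U (n + 1)) • (jonesWenzl U e n * e n) ∧
    jonesWenzl U e n * jonesWenzl U e (n + 1) = jonesWenzl U e (n + 1) ∧
    jonesWenzl U e (n + 1) * jonesWenzl U e n = jonesWenzl U e (n + 1) := by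
  induction n with
  | zero =>
    refine ⟨fun i hi => by omega, ?_, ?_, ?_⟩ <;> simp [jonesWenzl, hU1, hU2, hsq]
  | succ n ih =>
    obtain ⟨ha, he, hl, hr⟩ := ih fun m h1 h2 => hne m h1 (by omega)
    have hn1 : U (n + 1) ≠ 0 := hne _ (by omega) (by omega)
    have hn2 : U (n + 2) ≠ 0 := hne _ (by omega) (by omega)
    have hc1 : Commute (e (n + 1)) (jonesWenzl U e (n + 1)) :=
      commute_strandSubalgebra hcomm le_rfl (jonesWenzl_mem U e _)
    have hc0 : Commute (e n) (jonesWenzl U e n) :=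
      commute_strandSubalgebra hcomm le_rfl (jonesWenzl_mem U e _)
    have hidem : jonesWenzl U e (n + 1) * jonesWenzl U e (n + 1) = jonesWenzl U e (n + 1) :=
      jonesWenzl_mul_of_forall fun i hi => (ha i hi).1
    have hdef : jonesWenzl U e (n + 2) = jonesWenzl U e (n + 1) -
        (U (n + 1) / U (n + 2)) •
          (jonesWenzl U e (n + 1) * e n * jonesWenzl U e (n + 1)) := by rw [jonesWenzl]
    have hann : ∀ i, i + 1 < n + 2 →
        e i * jonesWenzl U e (n + 2) = 0 ∧ jonesWenzl U e (n + 2) * e i = 0 := by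
      intro i hi
      set f := jonesWenzl U e (n + 1)
      set g := jonesWenzl U e n
      have hcancel : U (n + 1) / U (n + 2) * (U (n + 2) / U (n + 1)) = 1 := by field_simp
      rcases Nat.lt_or_ge (i + 1) (n + 1) with h | h
      · obtain ⟨h1, h2⟩ := ha i h
        constructor
        · rw [hdef, mul_sub, mul_smul_comm, ← mul_assoc, ← mul_assoc, h1]
          simp
        · rw [hdef, sub_mul, smul_mul_assoc, mul_assoc, h2]
          simp
      · obtain rfl : i = n := by omega
        constructor
        -- The coefficient in the recursion is inverse to that of `e i * f * e i`. What remains is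
        -- `e i * f - g * e i * f`, which vanishes because g commutes with `e i` and is absorbed by
        -- f.
        · rw [hdef, mul_sub, mul_smul_comm, ← mul_assoc, ← mul_assoc, he, smul_mul_assoc, smul_smul,
            hcancel, one_smul, ← hc0.eq, mul_assoc, hl, sub_self]
        · rw [hdef, sub_mul, smul_mul_assoc, mul_assoc, mul_assoc, ← mul_assoc (e i), he,
            mul_smul_comm, smul_smul, hcancel, one_smul, ← mul_assoc, hr, sub_self]
    refine ⟨hann, ?_, ?_, ?_⟩
    · set f := jonesWenzl U e (n + 1)
      have h1 : e (n + 1) * f * e (n + 1) = δ • (f * e (n + 1)) := by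
        rw [hc1.eq, mul_assoc, hsq, mul_smul_comm]
      have h2 : e (n + 1) * (f * e n * f) * e (n + 1) = f * e (n + 1) := by
        calc e (n + 1) * (f * e n * f) * e (n + 1)
            = (e (n + 1) * f) * e n * (f * e (n + 1)) := by simp only [mul_assoc]
          _ = f * (e (n + 1) * e n * e (n + 1)) * f := by
            simp only [mul_assoc, ← hc1.eq]; simp only [← mul_assoc, hc1.eq]
          _ = f * e (n + 1) := by rw [hbraid, mul_assoc, hc1.eq, ← mul_assoc, hidem]
      rw [hdef, mul_sub, sub_mul, mul_smul_comm, smul_mul_assoc, h1, h2, ← sub_smul]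
      congr 1
      -- The coefficient is δ - U (n + 1) / U (n + 2), which the recursion turns into U (n + 3) / U
      -- (n + 2).
      rw [hU]
      field_simp
    · exact jonesWenzl_mul_of_forall fun i hi => (hann i (by omega)).1
    · exact mul_jonesWenzl_of_forall fun i hi => (hann i (by omega)).2

/-- The relation `e i = e i * e (i + 1) * e i` carries membership in the ideal of `e n` down from i
+ 1 to i. -/
theorem mem_span_mul_generator_mul {e : ℕ → A} {n : ℕ}
    (hbraid : ∀ i, i + 1 ≤ n → e i * e (i + 1) * e i = e i) {i : ℕ} (hi : i ≤ n) :
    ∃ a ∈ strandSubalgebra k e (n + 2), ∃ b ∈ strandSubalgebra k e (n + 2), e i = a * e n * b := by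
  induction hi using Nat.decreasingInduction with
  | self => exact ⟨1, Subalgebra.one_mem _, 1, Subalgebra.one_mem _, by simp⟩
  | of_succ i hi ih =>
    obtain ⟨a, ha, b, hb, h⟩ := ih
    have hei : e i ∈ strandSubalgebra k e (n + 2) := mem_strandSubalgebra e (by omega)
    refine ⟨e i * a, Subalgebra.mul_mem _ hei ha, b * e i, Subalgebra.mul_mem _ hb hei, ?_⟩
    conv_lhs => rw [← hbraid i hi, h]
    simp only [mul_assoc]

theorem one_sub_jonesWenzl_mem {U : ℕ → k} {e : ℕ → A} {n : ℕ}
    (hbraid : ∀ i, i + 1 ≤ n → e i * e (i + 1) * e i = e i) {m : ℕ} (hm : m ≤ n + 2) :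
    1 - jonesWenzl U e m ∈ Submodule.span k {y | ∃ a ∈ strandSubalgebra k e (n + 2),
      ∃ b ∈ strandSubalgebra k e (n + 2), y = a * e n * b} := by
  induction m using jonesWenzl.induct with
  | case1 => simp [jonesWenzl]
  | case2 => simp [jonesWenzl]
  | case3 m ih =>
    have hf : jonesWenzl U e (m + 1) ∈ strandSubalgebra k e (n + 2) :=
      strandSubalgebra_mono e (by omega) (jonesWenzl_mem U e _)
    obtain ⟨a, ha, b, hb, h⟩ := mem_span_mul_generator_mul (k := k) hbraid (i := m) (by omega)
    rw [jonesWenzl, ← sub_add]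
    refine Submodule.add_mem _ (ih (by omega)) (Submodule.smul_mem _ _ (Submodule.subset_span
      ⟨jonesWenzl U e (m + 1) * a, Subalgebra.mul_mem _ hf ha, b * jonesWenzl U e (m + 1),
        Subalgebra.mul_mem _ hb hf, ?_⟩))
    rw [h]
    simp only [mul_assoc]

theorem exists_mul_eq_smul_of_annihilates {e : ℕ → A} {n : ℕ} {f : A}
    (h : ∀ i, i + 1 < n → f * e i = 0) {x : A} (hx : x ∈ strandSubalgebra k e n) :
    ∃ c : k, f * x = c • f := by
  induction hx using Algebra.adjoin_induction with
  | mem x hx =>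
    obtain ⟨i, hi, rfl⟩ := hx
    exact ⟨0, by rw [h i hi, zero_smul]⟩
  | algebraMap r => exact ⟨r, by rw [← Algebra.commutes, ← Algebra.smul_def]⟩
  | add x y _ _ hx hy =>
    obtain ⟨c, hc⟩ := hx
    obtain ⟨d, hd⟩ := hy
    exact ⟨c + d, by rw [mul_add, hc, hd, add_smul]⟩
  | mul x y _ _ hx hy =>
    obtain ⟨c, hc⟩ := hx
    obtain ⟨d, hd⟩ := hy
    exact ⟨c * d, by rw [← mul_assoc, hc, smul_mul_assoc, hd, smul_smul]⟩

theorem exists_eq_smul_mul_of_annihilates {e : ℕ → A} {n : ℕ} {f : A}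
    (h : ∀ i, i + 1 < n → e i * f = 0) {x : A} (hx : x ∈ strandSubalgebra k e n) :
    ∃ c : k, x * f = c • f := by
  induction hx using Algebra.adjoin_induction with
  | mem x hx =>
    obtain ⟨i, hi, rfl⟩ := hx
    exact ⟨0, by rw [h i hi, zero_smul]⟩
  | algebraMap r => exact ⟨r, by rw [← Algebra.smul_def]⟩
  | add x y _ _ hx hy =>
    obtain ⟨c, hc⟩ := hx
    obtain ⟨d, hd⟩ := hy
    exact ⟨c + d, by rw [add_mul, hc, hd, add_smul]⟩
  | mul x y _ _ hx hy =>
    obtain ⟨c, hc⟩ := hx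
    obtain ⟨d, hd⟩ := hy
    exact ⟨d * c, by rw [mul_assoc, hd, mul_smul_comm, hc, smul_smul]⟩

theorem hasSplitFrame_strandSubalgebra {U : ℕ → k} {e : ℕ → A} {δ : k} {N : ℕ}
    (hsq : ∀ i, e i * e i = δ • e i)
    (hbraid : ∀ i, e (i + 1) * e i * e (i + 1) = e (i + 1))
    (hbraid' : ∀ i, i + 2 < N → e i * e (i + 1) * e i = e i)
    (hcomm : ∀ i j, i + 1 < j → Commute (e j) (e i))
    (hU1 : U 1 = 1) (hU2 : U 2 = δ) (hU : ∀ n, U (n + 3) = δ * U (n + 2) - U (n + 1))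
    (hne : ∀ m, 1 ≤ m → m ≤ N → U m ≠ 0) (n : ℕ) (hn : n ≤ N) :
    HasSplitFrame (strandSubalgebra k e n) := by
  induction n using Nat.twoStepInduction with
  | zero => rw [strandSubalgebra_eq_bot e (by omega)]; exact hasSplitFrame_bot
  | one => rw [strandSubalgebra_eq_bot e le_rfl]; exact hasSplitFrame_bot
  | more n ih _ =>
    have hann := (jonesWenzl_annihilates hsq hbraid hcomm hU1 hU2 hU (n + 1)
      fun m h1 h2 => hne m h1 (by omega)).1
    exact (ih (by omega)).extend (strandSubalgebra_mono e (by omega))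
      (mem_strandSubalgebra e (by omega)) (jonesWenzl_mem U e (n + 2))
      (fun x hx => commute_strandSubalgebra hcomm le_rfl hx)
      (fun x hx => exists_compress hsq hbraid hcomm hx)
      (fun x hx => exists_mul_eq_smul_of_annihilates (fun i hi => (hann i hi).2) hx)
      (fun x hx => exists_eq_smul_mul_of_annihilates (fun i hi => (hann i hi).1) hx)
      (hann n (by omega)).2 (hann n (by omega)).1
      (one_sub_jonesWenzl_mem (fun i hi => hbraid' i (by omega)) le_rfl)

end Tower

/-! ### The Temperley--Lieb algebra and quantum integers -/

section TemperleyLieb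

variable {k : Type*} [Field k]

/-- The generators of the Temperley--Lieb algebra, extended by zero to all indices. -/
def temperleyLiebGenerator (n : ℕ) (δ : k) (i : ℕ) : TemperleyLieb n δ :=
  if h : i < n - 1 then RingQuot.mkAlgHom k (TemperleyLiebRel n δ) (FreeAlgebra.ι k ⟨i, h⟩) else 0

theorem temperleyLiebGenerator_mul_self (n : ℕ) (δ : k) (i : ℕ) :
    temperleyLiebGenerator n δ i * temperleyLiebGenerator n δ i =
      δ • temperleyLiebGenerator n δ i := by
  unfold temperleyLiebGenerator
  split_ifs with h
  · simpa using RingQuot.mkAlgHom_rel k (TemperleyLiebRel.sq (δ := δ) ⟨i, h⟩)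
  · simp

theorem temperleyLiebGenerator_braid (n : ℕ) (δ : k) (i j : ℕ) (hj : j < n - 1)
    (h : |(i : ℤ) - (j : ℤ)| = 1) :
    temperleyLiebGenerator n δ i * temperleyLiebGenerator n δ j * temperleyLiebGenerator n δ i =
      temperleyLiebGenerator n δ i := by
  unfold temperleyLiebGenerator
  rw [dif_pos hj]
  split_ifs with hi
  · simpa using RingQuot.mkAlgHom_rel k (TemperleyLiebRel.braid (δ := δ) ⟨i, hi⟩ ⟨j, hj⟩ h)
  · simp

theorem temperleyLiebGenerator_commute (n : ℕ) (δ : k) (i j : ℕ) (h : i + 1 < j) :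
    Commute (temperleyLiebGenerator n δ j) (temperleyLiebGenerator n δ i) := by
  unfold temperleyLiebGenerator
  split_ifs with hj hi
  · have : 1 < |((⟨j, hj⟩ : Fin (n - 1)) : ℤ) - ((⟨i, hi⟩ : Fin (n - 1)) : ℤ)| := by
      rw [lt_abs]
      left
      simp only
      omega
    have := RingQuot.mkAlgHom_rel k (TemperleyLiebRel.comm (δ := δ) _ _ this)
    rwa [map_mul, map_mul] at this
  · exact Commute.zero_right _
  · exact Commute.zero_left _
  · exact Commute.zero_left _

theorem strandSubalgebra_temperleyLiebGenerator (n : ℕ) (δ : k) :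
    strandSubalgebra k (temperleyLiebGenerator n δ) n = ⊤ := by
  rw [eq_top_iff]
  intro x _
  obtain ⟨y, rfl⟩ := RingQuot.mkAlgHom_surjective k (TemperleyLiebRel n δ) x
  induction y using FreeAlgebra.induction with
  | grade0 r => rw [AlgHom.commutes]; exact Subalgebra.algebraMap_mem _ r
  | grade1 i =>
    have h := mem_strandSubalgebra (k := k) (temperleyLiebGenerator n δ) (n := n) (i := i)
      (by omega)
    rwa [temperleyLiebGenerator, dif_pos i.2] at h
  | mul a b ha hb => rw [map_mul]; exact Subalgebra.mul_mem _ (ha trivial) (hb trivial)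
  | add a b ha hb => rw [map_add]; exact Subalgebra.add_mem _ (ha trivial) (hb trivial)

/-- Only the recursion and nonvanishing of `U` enter, so one statement serves both signs of the
parameter. -/
theorem temperleyLieb_isSplitSemisimple (n : ℕ) (δ : k) {U : ℕ → k}
    (hU1 : U 1 = 1) (hU2 : U 2 = δ) (hU : ∀ n, U (n + 3) = δ * U (n + 2) - U (n + 1))
    (hne : ∀ m, 1 ≤ m → m ≤ n → U m ≠ 0) : IsSplitSemisimple k (TemperleyLieb n δ) := by
  refine HasSplitFrame.isSplitSemisimple ?_
  rw [← strandSubalgebra_temperleyLiebGenerator]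
  refine hasSplitFrame_strandSubalgebra (N := n) (temperleyLiebGenerator_mul_self n δ) ?_ ?_
    (temperleyLiebGenerator_commute n δ) hU1 hU2 hU hne n le_rfl
  -- With generators extended by zero this relation holds for every i, since `e (i + 1)` vanishes
  -- whenever `e i` does. The opposite one fails in general at the last nonzero generator, hence its
  -- bound on i.
  · intro i
    by_cases hi : i < n - 1
    · exact temperleyLiebGenerator_braid n δ _ _ hi (by simp)
    · have : temperleyLiebGenerator n δ (i + 1) = 0 := dif_neg (by omega)
      simp [this]
  · intro i hi
    exact temperleyLiebGenerator_braid n δ _ _ (by omega) (by simp)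

theorem balancedInt_one (v : k) : balancedInt v 1 = 1 := by
  simp [balancedInt]

theorem balancedInt_add_one (v : k) (hv : v ≠ 0) (n : ℕ) :
    balancedInt v (n + 1) = v⁻¹ * balancedInt v n + v ^ n := by
  rw [balancedInt, Finset.sum_range_succ, balancedInt, Finset.mul_sum]
  congr 1
  · refine Finset.sum_congr rfl fun j _ => ?_
    rw [← zpow_neg_one, ← zpow_add₀ hv]
    congr 1
    push_cast
    ring
  · rw [← zpow_natCast]
    congr 1
    push_cast
    ring

theorem balancedInt_two (v : k) (hv : v ≠ 0) : balancedInt v 2 = v + v⁻¹ := by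
  rw [balancedInt_add_one v hv, balancedInt_one]
  ring

theorem balancedInt_add_two (v : k) (hv : v ≠ 0) (n : ℕ) :
    balancedInt v (n + 2) = (v + v⁻¹) * balancedInt v (n + 1) - balancedInt v n := by
  rw [balancedInt_add_one v hv (n + 1), balancedInt_add_one v hv n]
  field_simp
  ring

end TemperleyLieb

theorem corollary4p5 {k : Type*} [Field k] (n : ℕ) (hn : 1 ≤ n) (v : k) (hv : v ≠ 0)
    (hδ : v + v⁻¹ ≠ 0) (hfac : balancedFactorial v n ≠ 0) :
    IsSplitSemisimple k (TemperleyLieb n (v + v⁻¹)) ∧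
      IsSplitSemisimple k (TemperleyLieb n (-(v + v⁻¹))) := by
  have hne : ∀ m, 1 ≤ m → m ≤ n → balancedInt v m ≠ 0 := fun m h1 h2 =>
    Finset.prod_ne_zero_iff.1 hfac m (Finset.mem_Icc.2 ⟨h1, h2⟩)
  constructor
  · exact temperleyLieb_isSplitSemisimple n _ (balancedInt_one v) (balancedInt_two v hv)
      (fun m => balancedInt_add_two v hv (m + 1)) hne
  -- The alternating sign turns the recursion for v + v⁻¹ into the one for its negative, keeping `U
  -- 1 = 1`.
  · refine temperleyLieb_isSplitSemisimple n _ (U := fun m => (-1) ^ (m + 1) * balancedInt v m)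
      (by simp [balancedInt_one]) (by simp [balancedInt_two v hv, pow_succ]) (fun m => ?_)
      (fun m h1 h2 => mul_ne_zero (pow_ne_zero _ (by simp)) (hne m h1 h2))
    simp only [balancedInt_add_two v hv (m + 1)]
    ring
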